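/- Define real polynomials $p_n(w)$, $n\ge 1$ (these occur in the derivatives of the Lambert $W$ function), by $p_1(w)=1$ and $$p_{n+1}(w) = -(nw+3n-1)\,p_n(w) + (1+w)\,p_n'(w)\qquad (n\ge 1).$$ Then $p_n$ has degree at most $n-1$, and we define real numbers $\beta_{n,k}$ ($0\le k\le n-1$) by $$p_n(w) = (-1)^{n-1}\sum_{k=0}^{n-1}\beta_{n,k}\,w^k .$$ For every $n\ge 3$ the sequence $\beta_{n,0},\beta_{n,1},\dots,\beta_{n,n-1}$ is (a) log-concave: $\beta_{n,k-1}\,\beta_{n,k+1}\le \beta_{n,k}^2$ for all $1\le k\le n-2$; and (b) unimodal: there is an index $0\le j\le n-1$ with $\beta_{n,0}\le \beta_{n,1}\le\dots\le\beta_{n,j}\ge\beta_{n,j+1}\ge\dots\ge\beta_{n,n-1}$. -/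

import Mathlib

open Polynomial

/-- The polynomials `p_n` (`n ≥ 1`) occurring in the derivatives of the Lambert `W` function:
`p_1 = 1` and `p_{n+1}(w) = -(n w + 3 n - 1) p_n(w) + (1 + w) p_n'(w)` for `n ≥ 1`.
The value at `n = 0` is a placeholder. -/
noncomputable def lambertPoly : ℕ → ℝ[X]
  | 0 => 0
  | 1 => 1
  | n + 2 =>
      -(((n + 1 : ℕ) : ℝ[X]) * X + 3 * ((n + 1 : ℕ) : ℝ[X]) - 1) * lambertPoly (n + 1)
        + (1 + X) * derivative (lambertPoly (n + 1))

/-- The coefficients `β_{n,k}`, given by `p_n(w) = (-1)^(n-1) ∑_{k=0}^{n-1} β_{n,k} w^k`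
for `n ≥ 1`. -/
noncomputable def lambertBeta (n k : ℕ) : ℝ :=
  (-1) ^ (n - 1) * (lambertPoly n).coeff k

/-- `p_n` has degree less than `n`, so that `β_{n,0}, …, β_{n,n-1}` are all its coefficients. -/
theorem natDegree_lambertPoly_succ_le (n : ℕ) : (lambertPoly (n + 1)).natDegree ≤ n := by
  induction n with
  | zero => simp [lambertPoly]
  | succ n ih =>
    rw [lambertPoly]
    refine natDegree_add_le_of_degree_le ?_ ?_
    · refine (natDegree_mul_le_of_le (m := 1) ?_ ih).trans (by omega)
      compute_degree
    · refine (natDegree_mul_le_of_le (m := 1) (n := n) (by compute_degree) ?_).trans (by omega)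
      exact (natDegree_derivative_le _).trans ((Nat.sub_le _ _).trans ih)

/-- The defining expansion of the coefficients `β_{n,k}`. -/
theorem lambertPoly_eq_sum {n : ℕ} (hn : 1 ≤ n) :
    lambertPoly n =
      C ((-1 : ℝ) ^ (n - 1)) * ∑ k ∈ Finset.range n, C (lambertBeta n k) * X ^ k := by
  obtain ⟨m, rfl⟩ := Nat.exists_eq_add_of_le' hn
  conv_lhs => rw [(lambertPoly (m + 1)).as_sum_range_C_mul_X_pow'
    (Nat.lt_succ_of_le (natDegree_lambertPoly_succ_le m))]
  rw [Finset.mul_sum]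
  refine Finset.sum_congr rfl fun k _ => ?_
  rw [← mul_assoc, ← C_mul, lambertBeta, ← mul_assoc, ← mul_pow]
  simp

/-- The finite real sequence `c_0, c_1, …, c_N` is unimodal: for some `0 ≤ j ≤ N`,
`c_0 ≤ c_1 ≤ … ≤ c_j ≥ c_{j+1} ≥ … ≥ c_N`. -/
def IsUnimodalSeq (N : ℕ) (c : ℕ → ℝ) : Prop :=
  ∃ j ≤ N, (∀ i, i < j → c i ≤ c (i + 1)) ∧ (∀ i, j ≤ i → i < N → c (i + 1) ≤ c i)

/-- The finite real sequence `c_0, c_1, …, c_N` is log-concave: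
`c_{k-1} c_{k+1} ≤ c_k ^ 2` for all `1 ≤ k ≤ N - 1`. -/
def IsLogConcaveSeq (N : ℕ) (c : ℕ → ℝ) : Prop :=
  ∀ k, 1 ≤ k → k + 1 ≤ N → c (k - 1) * c (k + 1) ≤ c k ^ 2

/-! Write p_{m+1}(w) = (-1)^m q_m(1+w). The coefficients of q_m satisfy a two-term recurrence with
nonnegative multipliers, which keeps them positive and log-concave
(`isPosLogConcave_coeff_shiftedLambertPoly`). Translation by 1 is e^D = lim (1 + D/N)^N, and each
factor 1 + eD preserves log-concavity (`add_mul_succ`), so the inequalities pass to the limit.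
Positivity then yields unimodality. -/

/-- The sequence `c` is positive at the indices below `m`, vanishes at the others, and is
log-concave. -/
structure IsPosLogConcave (m : ℕ) (c : ℕ → ℝ) : Prop where
  pos : ∀ k < m, 0 < c k
  zero : ∀ k, m ≤ k → c k = 0
  mul_le_sq : ∀ k, c k * c (k + 2) ≤ c (k + 1) ^ 2

namespace IsPosLogConcave

variable {m : ℕ} {c : ℕ → ℝ}

theorem nonneg (h : IsPosLogConcave m c) (k : ℕ) : 0 ≤ c k := by
  rcases lt_or_ge k m with hk | hk
  · exact (h.pos k hk).le
  · exact (h.zero k hk).ge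

/-- Multiply two consecutive log-concavity inequalities and cancel the positive inner product. -/
theorem mul_le_mul_inner (h : IsPosLogConcave m c) (k : ℕ) :
    c k * c (k + 3) ≤ c (k + 1) * c (k + 2) := by
  rcases lt_or_ge (k + 3) m with hk | hk
  · have h1 := h.pos (k + 1) (by omega)
    have h2 := h.pos (k + 2) (by omega)
    have key := mul_le_mul (h.mul_le_sq k) (h.mul_le_sq (k + 1))
      (mul_nonneg (h.nonneg _) (h.nonneg _)) (sq_nonneg _)
    refine le_of_mul_le_mul_right ?_ (mul_pos h1 h2)
    calc c k * c (k + 3) * (c (k + 1) * c (k + 2))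
        = c k * c (k + 2) * (c (k + 1) * c (k + 1 + 2)) := by ring_nf
      _ ≤ c (k + 1) ^ 2 * c (k + 1 + 1) ^ 2 := key
      _ = c (k + 1) * c (k + 2) * (c (k + 1) * c (k + 2)) := by ring_nf
  · rw [h.zero _ hk, mul_zero]
    exact mul_nonneg (h.nonneg _) (h.nonneg _)

/-- The coefficients of `f + e f'` are log-concave if those of `f` are and `0 ≤ e`. -/
theorem add_mul_succ (h : IsPosLogConcave m c) {e : ℝ} (he : 0 ≤ e) :
    IsPosLogConcave m fun k => c k + e * ((k + 1) * c (k + 1)) where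
  pos k hk := by
    have := h.pos k hk
    have := h.nonneg (k + 1)
    positivity
  zero k hk := by rw [h.zero k hk, h.zero (k + 1) (by omega)]; ring
  mul_le_sq k := by
    -- Group the difference by powers of `e`; `h3` appears because (k+2)^2 = (k+1)(k+3) + 1.
    have h0 := sub_nonneg.2 (h.mul_le_sq k)
    have h1 : 0 ≤ e * (k + 3) * (c (k + 1) * c (k + 2) - c k * c (k + 3)) :=
      mul_nonneg (by positivity) (sub_nonneg.2 (h.mul_le_mul_inner k))
    have h2 : 0 ≤ e ^ 2 * ((k + 1) * (k + 3)) * (c (k + 2) ^ 2 - c (k + 1) * c (k + 3)) :=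
      mul_nonneg (by positivity) (sub_nonneg.2 (h.mul_le_sq (k + 1)))
    have h3 : 0 ≤ e ^ 2 * c (k + 2) ^ 2 := by positivity
    rw [← sub_nonneg]
    refine (add_nonneg (add_nonneg (add_nonneg h0 h1) h2) h3).trans_eq ?_
    push_cast
    ring_nf

end IsPosLogConcave

/-- A positive log-concave sequence is unimodal. -/
theorem IsLogConcaveSeq.isUnimodalSeq {N : ℕ} {c : ℕ → ℝ} (hc : IsLogConcaveSeq N c)
    (hpos : ∀ k ≤ N, 0 < c k) :
    IsUnimodalSeq N c := by
  classical
  -- The peak is the first index not followed by a strict increase.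
  have hex : ∃ j, j = N ∨ c (j + 1) ≤ c j := ⟨N, Or.inl rfl⟩
  have hle : Nat.find hex ≤ N := Nat.find_min' hex (Or.inl rfl)
  refine ⟨Nat.find hex, hle, fun i hi => ?_, fun i hi => ?_⟩
  · have := Nat.find_min hex hi
    push Not at this
    exact this.2.le
  · induction i, hi using Nat.le_induction with
    | base =>
      intro hN
      exact (Nat.find_spec hex).resolve_left hN.ne
    | succ i _ ih =>
      intro hN
      have h1 := ih (by omega)
      have h2 := hc (i + 1) (by omega) (by omega)
      have hi := hpos i (by omega)
      have hi1 := hpos (i + 1) (by omega)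
      simp only [Nat.add_sub_cancel] at h2
      refine le_of_mul_le_mul_left (h2.trans ?_) hi
      nlinarith

/-! ### Translation as a limit of powers of 1 + D/N -/

/-- The operator `1 + e D` on real polynomials. -/
noncomputable def oneAddSmulDerivative (e : ℝ) : Module.End ℝ ℝ[X] :=
  1 + e • derivative

theorem coeff_oneAddSmulDerivative (e : ℝ) (f : ℝ[X]) (k : ℕ) :
    (oneAddSmulDerivative e f).coeff k = f.coeff k + e * ((k + 1) * f.coeff (k + 1)) := by
  simp [oneAddSmulDerivative, coeff_derivative, mul_comm]

theorem isPosLogConcave_oneAddSmulDerivative_pow {m : ℕ} {f : ℝ[X]}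
    (h : IsPosLogConcave m f.coeff) {e : ℝ} (he : 0 ≤ e) (N : ℕ) :
    IsPosLogConcave m ((oneAddSmulDerivative e ^ N) f).coeff := by
  induction N with
  | zero => simpa using h
  | succ N ih =>
    rw [pow_succ', Module.End.mul_apply]
    simpa only [← coeff_oneAddSmulDerivative] using ih.add_mul_succ he

/-- Binomial theorem, with a summation range independent of `N` so that limits can be taken
termwise. -/
theorem oneAddSmulDerivative_pow_apply (e : ℝ) (N : ℕ) (f : ℝ[X]) :
    (oneAddSmulDerivative e ^ N) f =
      ∑ j ∈ Finset.range (f.natDegree + 1),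
        ((N.choose j : ℝ) * e ^ j * j.factorial) • hasseDeriv j f := by
  have h : (oneAddSmulDerivative e ^ N) f = ∑ j ∈ Finset.range (N + 1),
      ((N.choose j : ℝ) * e ^ j * j.factorial) • hasseDeriv j f := by
    rw [oneAddSmulDerivative, add_comm, (Commute.one_right _).add_pow, LinearMap.sum_apply]
    refine Finset.sum_congr rfl fun j _ => ?_
    have hj : (j.factorial : ℝ) • hasseDeriv j f = derivative^[j] f := by
      rw [← factorial_smul_hasseDeriv]; simp [Nat.cast_smul_eq_nsmul]
    rw [mul_smul, hj, one_pow, mul_one, _root_.smul_pow, ← Nat.cast_comm, ← nsmul_eq_mul,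
      ← Nat.cast_smul_eq_nsmul ℝ, mul_smul]
    simp [Module.End.pow_apply]
  have aux : ∀ a b : ℕ, a ≤ b → (∀ j, a < j → ((N.choose j : ℝ) * e ^ j * j.factorial) •
      hasseDeriv j f = 0) → ∑ j ∈ Finset.range (a + 1), ((N.choose j : ℝ) * e ^ j * j.factorial) •
      hasseDeriv j f = ∑ j ∈ Finset.range (b + 1), ((N.choose j : ℝ) * e ^ j * j.factorial) •
      hasseDeriv j f := fun a b hab h0 =>
    Finset.sum_subset (Finset.range_mono (by omega)) fun j _ hj =>
      h0 j (by simpa [Nat.lt_succ_iff] using hj)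
  rw [h]
  rcases le_total N f.natDegree with hN | hN
  · exact aux _ _ hN fun j hj => by simp [Nat.choose_eq_zero_of_lt hj]
  · exact (aux _ _ hN fun j hj => by rw [hasseDeriv_eq_zero_of_lt_natDegree f j hj, smul_zero]).symm

theorem tendsto_choose_mul_inv_pow_mul_factorial (j : ℕ) :
    Filter.Tendsto (fun N : ℕ => (N.choose j : ℝ) * (N : ℝ)⁻¹ ^ j * j.factorial)
      Filter.atTop (nhds 1) := by
  have h : ∀ N : ℕ, (N.choose j : ℝ) * (N : ℝ)⁻¹ ^ j * j.factorial =
      (N.descFactorial j : ℝ) * (N : ℝ)⁻¹ ^ j := fun N => by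
    rw [Nat.descFactorial_eq_factorial_mul_choose]; push_cast; ring
  simp only [h]
  induction j with
  | zero => simp
  | succ j ih =>
    have h1 : Filter.Tendsto (fun N : ℕ => 1 - (j : ℝ) * (N : ℝ)⁻¹) Filter.atTop (nhds 1) := by
      simpa using (tendsto_inv_atTop_nhds_zero_nat (𝕜 := ℝ)).const_mul (j : ℝ) |>.const_sub 1
    have h2 := h1.mul (ih fun N => by
      rw [Nat.descFactorial_eq_factorial_mul_choose]; push_cast; ring)
    rw [one_mul] at h2
    refine h2.congr' ?_
    filter_upwards [Filter.eventually_gt_atTop j] with N hN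
    have hN0 : (N : ℝ) ≠ 0 := by
      have : 0 < N := by omega
      positivity
    rw [Nat.descFactorial_succ, Nat.cast_mul, Nat.cast_sub hN.le]
    rw [pow_succ]
    generalize (N : ℝ)⁻¹ ^ j = x
    field_simp

theorem tendsto_coeff_oneAddSmulDerivative_pow (f : ℝ[X]) (k : ℕ) :
    Filter.Tendsto (fun N : ℕ => ((oneAddSmulDerivative (N : ℝ)⁻¹ ^ N) f).coeff k)
      Filter.atTop (nhds ((taylor 1 f).coeff k)) := by
  have h : (taylor 1 f).coeff k =
      ∑ j ∈ Finset.range (f.natDegree + 1), 1 * (hasseDeriv j f).coeff k := by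
    have hle : (hasseDeriv k f).natDegree < f.natDegree + 1 :=
      Nat.lt_succ_of_le ((natDegree_hasseDeriv_le f k).trans (Nat.sub_le _ _))
    rw [taylor_coeff, eval_eq_sum_range' hle]
    refine Finset.sum_congr rfl fun j _ => ?_
    rw [hasseDeriv_coeff, hasseDeriv_coeff, one_pow, mul_one, one_mul, add_comm k j,
      Nat.choose_symm_add]
  rw [h]
  simp only [oneAddSmulDerivative_pow_apply, finsetSum_coeff, coeff_smul, smul_eq_mul]
  exact tendsto_finsetSum _ fun j _ =>
    (tendsto_choose_mul_inv_pow_mul_factorial j).mul_const _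

/-- Translation by `1` preserves log-concavity of the coefficients. -/
theorem coeff_taylor_one_mul_le_sq {m : ℕ} {f : ℝ[X]} (h : IsPosLogConcave m f.coeff) (k : ℕ) :
    (taylor 1 f).coeff k * (taylor 1 f).coeff (k + 2) ≤ (taylor 1 f).coeff (k + 1) ^ 2 :=
  le_of_tendsto_of_tendsto'
    ((tendsto_coeff_oneAddSmulDerivative_pow f k).mul
      (tendsto_coeff_oneAddSmulDerivative_pow f (k + 2)))
    ((tendsto_coeff_oneAddSmulDerivative_pow f (k + 1)).pow 2)
    fun N => (isPosLogConcave_oneAddSmulDerivative_pow h (by positivity) N).mul_le_sq k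

theorem coeff_taylor_one_pos {m : ℕ} {f : ℝ[X]} (h : IsPosLogConcave m f.coeff) {k : ℕ}
    (hk : k < m) : 0 < (taylor 1 f).coeff k := by
  refine (h.pos k hk).trans_le (ge_of_tendsto' (tendsto_coeff_oneAddSmulDerivative_pow f k)
    fun N => ?_)
  -- Positivity could be lost in the limit, so bound below by the coefficient of `f`. Freeing `e`
  -- from `N` allows induction on the exponent.
  generalize hN : (N : ℝ)⁻¹ = e
  have he : 0 ≤ e := hN ▸ by positivity
  clear hN
  induction N with
  | zero => simp
  | succ N ih =>
    rw [pow_succ', Module.End.mul_apply, coeff_oneAddSmulDerivative]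
    have := (isPosLogConcave_oneAddSmulDerivative_pow h he N).nonneg (k + 1)
    exact ih.trans (le_add_of_nonneg_right (by positivity))

/-! ### The polynomials in the variable 1 + w -/

/-- The polynomials `q_m` with `p_{m+1}(w) = (-1)^m q_m(1 + w)`. -/
noncomputable def shiftedLambertPoly : ℕ → ℝ[X]
  | 0 => 1
  | m + 1 => (((m + 1 : ℕ) : ℝ[X]) * X + ((2 * m + 1 : ℕ) : ℝ[X])) * shiftedLambertPoly m
      - X * derivative (shiftedLambertPoly m)

theorem lambertPoly_succ_eq_taylor (m : ℕ) :
    lambertPoly (m + 1) = (-1) ^ m * taylor 1 (shiftedLambertPoly m) := by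
  induction m with
  | zero => simp [lambertPoly, shiftedLambertPoly]
  | succ m ih =>
    have hd : derivative ((-1 : ℝ[X]) ^ m * taylor 1 (shiftedLambertPoly m)) =
        (-1) ^ m * taylor 1 (derivative (shiftedLambertPoly m)) := by
      have : ((-1 : ℝ[X]) ^ m) = C ((-1) ^ m) := by simp
      rw [this, derivative_C_mul]
      simp [taylor_apply, derivative_comp]
    rw [lambertPoly, ih, hd, shiftedLambertPoly, map_sub, taylor_mul, taylor_mul, map_add,
      taylor_mul]
    simp only [taylor_X, map_one]
    have hn : ∀ n : ℕ, taylor (1 : ℝ) (n : ℝ[X]) = n := fun n => by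
      rw [← C_eq_natCast, taylor_C]
    rw [hn, hn]
    push_cast
    ring

theorem coeff_shiftedLambertPoly_succ_zero (m : ℕ) :
    (shiftedLambertPoly (m + 1)).coeff 0 = (2 * m + 1) * (shiftedLambertPoly m).coeff 0 := by
  simp [shiftedLambertPoly, mul_coeff_zero]

theorem coeff_shiftedLambertPoly_succ_succ (m k : ℕ) :
    (shiftedLambertPoly (m + 1)).coeff (k + 1) =
      (2 * m - k) * (shiftedLambertPoly m).coeff (k + 1)
        + (m + 1) * (shiftedLambertPoly m).coeff k := by
  rw [shiftedLambertPoly, add_mul, mul_assoc, coeff_sub, coeff_add, ← C_eq_natCast,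
    ← C_eq_natCast, coeff_C_mul, coeff_C_mul, coeff_X_mul, coeff_X_mul, coeff_derivative]
  push_cast
  ring

theorem isPosLogConcave_coeff_shiftedLambertPoly (m : ℕ) :
    IsPosLogConcave (m + 1) (shiftedLambertPoly m).coeff := by
  induction m with
  | zero =>
    refine ⟨fun k hk => ?_, fun k hk => ?_, fun k => ?_⟩
    · simp [show k = 0 by omega, shiftedLambertPoly]
    · simp [shiftedLambertPoly, coeff_one, show k ≠ 0 by omega]
    · simp [shiftedLambertPoly, coeff_one]
  | succ m ih =>
    have hzero : ∀ k, m + 2 ≤ k → (shiftedLambertPoly (m + 1)).coeff k = 0 := by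
      intro k hk
      obtain ⟨k, rfl⟩ := Nat.exists_eq_add_of_le' (show 1 ≤ k by omega)
      rw [coeff_shiftedLambertPoly_succ_succ, ih.zero k (by omega), ih.zero (k + 1) (by omega)]
      ring
    have hpos : ∀ k < m + 2, 0 < (shiftedLambertPoly (m + 1)).coeff k := by
      rintro (_ | k) hk
      · rw [coeff_shiftedLambertPoly_succ_zero]
        have := ih.pos 0 (by omega)
        positivity
      · rw [coeff_shiftedLambertPoly_succ_succ]
        have h1 := ih.pos k (by omega)
        have h2 := ih.nonneg (k + 1)
        have h3 : (k : ℝ) ≤ m := by exact_mod_cast (show k ≤ m by omega)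
        have h4 : (0 : ℝ) ≤ 2 * m - k := by linarith [(Nat.cast_nonneg m : (0 : ℝ) ≤ m)]
        positivity
    refine ⟨hpos, hzero, fun k => ?_⟩
    rcases lt_or_ge (k + 2) (m + 2) with hk | hk
    swap
    · rw [hzero _ hk, mul_zero]; positivity
    have hkm : (k : ℝ) + 1 ≤ m := by exact_mod_cast (show k + 1 ≤ m by omega)
    rw [← sub_nonneg]
    -- The constant coefficient has a one-term recurrence, hence a separate case.
    obtain _ | k := k
    · rw [zero_add, zero_add, coeff_shiftedLambertPoly_succ_zero,
        coeff_shiftedLambertPoly_succ_succ m 0, coeff_shiftedLambertPoly_succ_succ m 1]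
      have h0 := ih.mul_le_sq 0
      have p0 := ih.nonneg 0
      have p1 := ih.nonneg 1
      have p2 := ih.nonneg 2
      have hm1 : (0 : ℝ) ≤ m - 1 := by simpa using hkm
      generalize (shiftedLambertPoly m).coeff = a at *
      norm_num at h0 ⊢
      have e0 : 0 ≤ (2 * m : ℝ) ^ 2 * (a 1 ^ 2 - a 0 * a 2) :=
        mul_nonneg (by positivity) (sub_nonneg.2 h0)
      have e1 : 0 ≤ ((m : ℝ) + 1) * (2 * m - 1) * (a 0 * a 1) :=
        mul_nonneg (mul_nonneg (by positivity) (by linarith)) (mul_nonneg p0 p1)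
      have e2 : 0 ≤ a 0 * a 2 := mul_nonneg p0 p2
      have e3 : 0 ≤ ((m : ℝ) + 1) ^ 2 * a 0 ^ 2 := by positivity
      linarith
    · rw [coeff_shiftedLambertPoly_succ_succ, coeff_shiftedLambertPoly_succ_succ,
        coeff_shiftedLambertPoly_succ_succ]
      have h0 := ih.mul_le_sq k
      have h1 := ih.mul_le_sq (k + 1)
      have h2 := ih.mul_le_mul_inner k
      have p1 := ih.nonneg (k + 1)
      have p2 := ih.nonneg (k + 2)
      have p3 := ih.nonneg (k + 3)
      generalize (shiftedLambertPoly m).coeff = a at *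
      push_cast at *
      -- Here `e3` absorbs the 1 in (2m-k-1)^2 = (2m-k)(2m-k-2) + 1.
      have e0 : 0 ≤ ((m : ℝ) + 1) ^ 2 * (a (k + 1) ^ 2 - a k * a (k + 2)) :=
        mul_nonneg (by positivity) (sub_nonneg.2 h0)
      have e1 : 0 ≤ (2 * m - k - 1 : ℝ) ^ 2 * (a (k + 2) ^ 2 - a (k + 1) * a (k + 3)) :=
        mul_nonneg (by positivity) (sub_nonneg.2 h1)
      have e2 : 0 ≤ ((m : ℝ) + 1) * (2 * m - k - 2) *
          (a (k + 1) * a (k + 2) - a k * a (k + 3)) :=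
        mul_nonneg (mul_nonneg (by positivity)
          (by linarith [(Nat.cast_nonneg k : (0 : ℝ) ≤ k)])) (sub_nonneg.2 h2)
      have e3 : 0 ≤ a (k + 1) * a (k + 3) := mul_nonneg p1 p3
      refine (add_nonneg (add_nonneg (add_nonneg e0 e1) e2) e3).trans_eq ?_
      ring_nf

theorem lambertBeta_succ (m k : ℕ) :
    lambertBeta (m + 1) k = (taylor 1 (shiftedLambertPoly m)).coeff k := by
  have : ((-1 : ℝ[X]) ^ m) = C ((-1) ^ m) := by simp
  rw [lambertBeta, lambertPoly_succ_eq_taylor, this, coeff_C_mul, ← mul_assoc,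
    Nat.add_sub_cancel, ← mul_pow]
  simp

theorem mainTheorem4 (n : ℕ) (hn : 3 ≤ n) :
    IsLogConcaveSeq (n - 1) (fun k => lambertBeta n k) ∧
      IsUnimodalSeq (n - 1) (fun k => lambertBeta n k) := by
  obtain ⟨m, rfl⟩ := Nat.exists_eq_add_of_le' (show 1 ≤ n by omega)
  have h := isPosLogConcave_coeff_shiftedLambertPoly m
  simp only [lambertBeta_succ, Nat.add_sub_cancel]
  have hc : IsLogConcaveSeq m fun k => (taylor 1 (shiftedLambertPoly m)).coeff k := by
    intro k hk _
    obtain ⟨k, rfl⟩ := Nat.exists_eq_add_of_le' hk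
    exact coeff_taylor_one_mul_le_sq h k
  exact ⟨hc, hc.isUnimodalSeq fun k hk => coeff_taylor_one_pos h (Nat.lt_succ_of_le hk)⟩
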